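/- Let $r\in\mathbb N$ and $p\in[1,\infty)$. Let $\mathcal M_r$ denote the algebra of complex $r\times r$ matrices with the operator norm induced by the Euclidean norm of $\mathbb C^r$. A function $h\in L_1((-1,1),\mathcal M_r)$ is called an accelerant if for each $\alpha\in(0,1]$ the integral equation $$f(x)+\int_0^\alpha h(x-t)f(t)\,dt=0,\qquad x\in(0,1)\ \text{(almost everywhere)},$$ has only the zero solution in $L_2((0,1),\mathbb C^r)$. Let $\mathfrak H_{p,r}$ denote the set of accelerants that belong to $L_p((-1,1),\mathcal M_r)$. Then $\mathfrak H_{p,r}$ is dense in $L_p((-1,1),\mathcal M_r)$. -/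

import Mathlib

open MeasureTheory Set
open scoped ENNReal Matrix.Norms.L2Operator

/-- The restriction of Lebesgue measure to the open interval `(a, b)`. -/
noncomputable abbrev lebesgueOn (a b : ℝ) : Measure ℝ := volume.restrict (Ioo a b)

/-- The algebra of complex `r × r` matrices. Its norm is the operator norm of the action on the
Euclidean space `ℂ^r` (the scoped instances `Matrix.Norms.L2Operator` opened above). -/
abbrev ComplexMatrix (r : ℕ) : Type := Matrix (Fin r) (Fin r) ℂ

/-- A function `h ∈ L₁((-1,1), M_r)` is an accelerant if for each `α ∈ (0,1]` the equation
`f(x) + ∫₀^α h(x-t) f(t) dt = 0`, for almost every `x ∈ (0,1)`, has only the zero solution in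
`L₂((0,1), ℂ^r)`. For `x, t ∈ (0,1)` the argument `x - t` lies in `(-1,1)`, so only the values of
`h` on `(-1,1)` matter, and only up to null sets. The integrand is integrable in `t` for almost
every `x`, as `h` is integrable and `f` is square integrable. -/
def IsAccelerant {r : ℕ} (h : ℝ → ComplexMatrix r) : Prop :=
  Integrable h (lebesgueOn (-1) 1) ∧
    ∀ α ∈ Ioc (0 : ℝ) 1, ∀ f : Lp (EuclideanSpace ℂ (Fin r)) 2 (lebesgueOn 0 1),
      (∀ᵐ x ∂(lebesgueOn 0 1),
        f x + ∫ t in (0 : ℝ)..α, Matrix.toEuclideanCLM (𝕜 := ℂ) (h (x - t)) (f t) = 0) →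
      f = 0

/-- The set of accelerants that belong to `L_p((-1,1), M_r)`. -/
def accelerants (p : ℝ≥0∞) (r : ℕ) : Set (Lp (ComplexMatrix r) p (lebesgueOn (-1) 1)) :=
  {h | IsAccelerant (h : ℝ → ComplexMatrix r)}

/-! Polynomials are dense in `L_p`, since `p < ∞`, so it suffices to approximate a polynomial kernel
`q` by multiples `z • q` that are accelerants, with `z` near `1`. Expanding `q (x - t)` in powers of
`x` gives a kernel of finite rank, and the equation on `[0, α]` becomes a linear system with matrix
`1 + z • M(α)`, where `M` is `C¹` in `α` (`eq_zero_of_separable_kernel`).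

The difficulty is that one `z` must serve all `α` at once. The bad `z` are roots of the polynomials
`det (1 + z • M(α))`, nonzero because they equal `1` at `z = 0`. Where the roots are simple they
move along Lipschitz curves, and a multiple root is a simple root of some derivative. The bad set
thus has Hausdorff dimension at most one in the plane, and its complement is dense
(`dense_compl_setOf_exists_isRoot`). -/

/-! ### Roots of one-parameter families of polynomials -/

/-- The zeros of a strictly differentiable function on `ℂ × ℝ` form, near a zero at which the
derivative along `ℂ` is multiplication by a nonzero number, a Lipschitz graph over `ℝ`. -/
theorem HasStrictFDerivAt.exists_antilipschitzOn_snd {F : ℂ × ℝ → ℂ} {x : ℂ × ℝ}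
    {L : ℂ × ℝ →L[ℝ] ℂ} (hF : HasStrictFDerivAt F L x) {l : ℂ} (hl : l ≠ 0)
    (hL : ∀ z : ℂ, L (z, 0) = l * z) :
    ∃ K : NNReal, ∃ U ∈ nhds x, ∀ a ∈ U, ∀ b ∈ U, F a = 0 → F b = 0 →
      dist a b ≤ K * dist a.2 b.2 := by
  -- With error constant `‖l‖ / 2`, the part of the error coming from `a.1 - b.1` is absorbed by
  -- half of `‖l‖ * ‖a.1 - b.1‖`.
  have hc : 0 < ‖l‖ / 2 := half_pos (norm_pos_iff.2 hl)
  have h := hF.isLittleO.def hc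
  rw [nhds_prod_eq] at h
  obtain ⟨U, hU, h⟩ := Filter.mem_prod_same_iff.1 h
  refine ⟨1 + ⟨2 * ‖L (0, 1)‖ / ‖l‖ + 1, by positivity⟩, U, hU, fun a ha b hb hFa hFb => ?_⟩
  have h1 : ‖F a - F b - L (a - b)‖ ≤ _ * ‖a - b‖ := h (mk_mem_prod ha hb)
  simp only [hFa, hFb, sub_zero, zero_sub, norm_neg] at h1
  have e : L (a - b) = l * (a.1 - b.1) + (a.2 - b.2) • L (0, 1) := by
    rw [← hL, ← L.map_smul, ← L.map_add]
    congr 1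
    ext <;> simp
  have h2 : ‖l‖ * ‖a.1 - b.1‖ ≤ ‖L (a - b)‖ + ‖a.2 - b.2‖ * ‖L (0, 1)‖ := by
    rw [← norm_mul, ← norm_smul, eq_sub_of_add_eq e.symm]
    exact norm_sub_le _ _
  have h3 : ‖a - b‖ ≤ ‖a.1 - b.1‖ + ‖a.2 - b.2‖ := by
    rw [Prod.norm_def]
    exact max_le (by simp) (by simp)
  have h4 : ‖a.1 - b.1‖ ≤ (2 * ‖L (0, 1)‖ / ‖l‖ + 1) * ‖a.2 - b.2‖ := by
    have hl' := norm_pos_iff.2 hl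
    have : ‖l‖ * ‖a.1 - b.1‖ ≤ ‖l‖ * ((2 * ‖L (0, 1)‖ / ‖l‖ + 1) * ‖a.2 - b.2‖) := by
      have : ‖l‖ * ((2 * ‖L (0, 1)‖ / ‖l‖ + 1) * ‖a.2 - b.2‖)
          = (2 * ‖L (0, 1)‖ + ‖l‖) * ‖a.2 - b.2‖ := by
        field_simp
      rw [this]
      nlinarith
    exact le_of_mul_le_mul_left this hl'
  rw [dist_eq_norm, dist_eq_norm]
  refine h3.trans ?_
  have : ((1 + ⟨2 * ‖L (0, 1)‖ / ‖l‖ + 1, by positivity⟩ : NNReal) : ℝ)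
    = 1 + (2 * ‖L (0, 1)‖ / ‖l‖ + 1) := rfl
  rw [this]
  linarith

/-- The projection to `ℝ` is antilipschitz on `s`, hence cannot lower the dimension. -/
theorem dimH_le_one_of_dist_le_snd {s : Set (ℂ × ℝ)} {K : NNReal}
    (h : ∀ a ∈ s, ∀ b ∈ s, dist a b ≤ K * dist a.2 b.2) : dimH s ≤ 1 := by
  have hA : AntilipschitzWith K (fun a : s => (a : ℂ × ℝ).2) :=
    AntilipschitzWith.of_le_mul_dist fun a b => h a a.2 b b.2
  have e : ((↑) : s → ℂ × ℝ) '' univ = s := by simp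
  rw [← e, (isometry_subtype_coe (s := s)).dimH_image]
  refine (hA.le_dimH_image univ).trans ((dimH_mono (subset_univ _)).trans ?_)
  simp [Real.dimH_univ]

/-- The first projection of a set of simple zeros has Hausdorff dimension at most one. -/
theorem dimH_image_fst_zeros_le_one {F : ℂ × ℝ → ℂ} {l : ℂ × ℝ → ℂ} (hF : ContDiff ℝ 1 F)
    (hl : ∀ z a, HasDerivAt (fun w => F (w, a)) (l (z, a)) z) :
    dimH (Prod.fst '' {x | F x = 0 ∧ l x ≠ 0}) ≤ 1 := by
  refine (LipschitzWith.prod_fst.dimH_image_le _).trans ?_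
  -- A dimension above one would already be attained in every neighbourhood of some point of the
  -- set, but near each point the set is a Lipschitz graph over `ℝ`.
  by_contra! hlt
  obtain ⟨x, hx, hx'⟩ := exists_mem_nhdsWithin_lt_dimH_of_lt_dimH hlt
  have hs : HasStrictFDerivAt F (fderiv ℝ F x) x :=
    hF.contDiffAt.hasStrictFDerivAt (by norm_num)
  obtain ⟨K, U, hU, h⟩ := hs.exists_antilipschitzOn_snd hx.2 (fun z => by
    have h1 : HasFDerivAt (fun w => F (w, x.2)) _ x.1 :=
      hs.hasFDerivAt.comp x.1 ((hasFDerivAt_id (𝕜 := ℝ) x.1).prodMk (hasFDerivAt_const x.2 x.1))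
    have h2 := (hl x.1 x.2).hasFDerivAt.restrictScalars ℝ
    have := congrArg (fun M => M z) (h1.unique h2)
    simpa [mul_comm] using this)
  refine (hx' (U ∩ {x | F x = 0 ∧ l x ≠ 0})
    (Filter.inter_mem (mem_nhdsWithin_of_mem_nhds hU) self_mem_nhdsWithin)).not_ge ?_
  exact dimH_le_one_of_dist_le_snd fun a ha b hb => h a ha.1 b hb.1 ha.2.1 hb.2.1

/-- A family of nonzero complex polynomials of bounded degree, with coefficients depending in a
`C¹` way on one real parameter: almost no complex number is a root of a member of the family. -/
theorem dense_compl_setOf_exists_isRoot {Q : ℝ → Polynomial ℂ} {N : ℕ}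
    (hdeg : ∀ a, (Q a).natDegree ≤ N) (hQ : ∀ k, ContDiff ℝ 1 fun a => (Q a).coeff k)
    (h0 : ∀ a, Q a ≠ 0) : Dense {z : ℂ | ∃ a, (Q a).IsRoot z}ᶜ := by
  let F : ℕ → ℂ × ℝ → ℂ := fun k x => (Polynomial.derivative^[k] (Q x.2)).eval x.1
  have hF : ∀ k, ContDiff ℝ 1 (F k) := fun k => by
    have : F k = fun x => ∑ i ∈ Finset.range (N + 1),
        (((i + k).descFactorial k : ℂ) * (Q x.2).coeff (i + k)) * x.1 ^ i := by
      ext x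
      rw [show F k x = _ from Polynomial.eval_eq_sum_range'
        (((Polynomial.natDegree_iterate_derivative _ _).trans
          ((Nat.sub_le _ _).trans (hdeg x.2))).trans_lt N.lt_succ_self) _]
      simp [Polynomial.coeff_iterate_derivative]
    rw [this]
    refine ContDiff.sum fun i _ => ?_
    exact (contDiff_const.mul ((hQ _).comp contDiff_snd)).mul (contDiff_fst.pow i)
  have hl : ∀ k z a, HasDerivAt (fun w => F k (w, a)) (F (k + 1) (z, a)) z := fun k z a => by
    simp only [F, Function.iterate_succ_apply']
    exact Polynomial.hasDerivAt _ _
  -- A root of a nonzero polynomial has finite multiplicity, so along the successive derivatives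
  -- there is a last one before the first nonzero value; there the zero is simple.
  have hsub : {z : ℂ | ∃ a, (Q a).IsRoot z} ⊆
      ⋃ k, Prod.fst '' {x | F k x = 0 ∧ F (k + 1) x ≠ 0} := by
    rintro z ⟨a, hz⟩
    by_contra hno
    simp only [mem_iUnion, not_exists] at hno
    have hall : ∀ k, F k (z, a) = 0 := fun k => by
      induction k with
      | zero => exact hz
      | succ k ih =>
        by_contra hne
        exact hno k ⟨(z, a), ⟨ih, hne⟩, rfl⟩
    exact lt_irrefl _ ((Polynomial.lt_rootMultiplicity_iff_isRoot_iterate_derivative (h0 a)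
      (t := z)).2 fun m _ => hall m)
  refine dense_compl_of_dimH_lt_finrank ?_
  refine ((dimH_mono hsub).trans ?_ : _ ≤ (1 : ℝ≥0∞)).trans_lt ?_
  · rw [dimH_iUnion]
    exact iSup_le fun k => dimH_image_fst_zeros_le_one (hF k) (hl k)
  · rw [Complex.finrank_real_complex]
    norm_num

/-! ### Determinants along paths of matrices -/

theorem contDiff_coeff_finsetProd {ι : Type*} (s : Finset ι) {P : ι → ℝ → Polynomial ℂ}
    (h : ∀ i ∈ s, ∀ k, ContDiff ℝ 1 fun a => (P i a).coeff k) (k : ℕ) :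
    ContDiff ℝ 1 fun a => (∏ i ∈ s, P i a).coeff k := by
  classical
  induction s using Finset.induction_on generalizing k with
  | empty => simpa using contDiff_const
  | insert i s hi ih =>
    simp only [Finset.prod_insert hi, Polynomial.coeff_mul]
    exact ContDiff.sum fun x _ => (h i (by simp) _).mul
      (ih (fun j hj => h j (Finset.mem_insert_of_mem hj)) _)

theorem contDiff_coeff_det {m : Type*} [Fintype m] [DecidableEq m]
    {A : ℝ → Matrix m m (Polynomial ℂ)}
    (h : ∀ i j k, ContDiff ℝ 1 fun a => (A a i j).coeff k) (k : ℕ) :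
    ContDiff ℝ 1 fun a => (A a).det.coeff k := by
  simp only [Matrix.det_apply, Polynomial.finsetSum_coeff, Units.smul_def, Polynomial.coeff_smul]
  refine ContDiff.sum fun σ _ => ContDiff.const_smul _ ?_
  exact contDiff_coeff_finsetProd _ (fun i _ => h _ _) k

/-- For a `C¹` path `G` of square matrices, the matrix `1 + z G(a)` is invertible for all `a`,
apart from a set of `z` with dense complement. -/
theorem dense_setOf_forall_det_one_add_smul_ne_zero {m : Type*} [Fintype m] [DecidableEq m]
    {G : ℝ → Matrix m m ℂ} (hG : ∀ i j, ContDiff ℝ 1 fun a => G a i j) :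
    Dense {z : ℂ | ∀ a, (1 + z • G a).det ≠ 0} := by
  let Q : ℝ → Polynomial ℂ := fun a =>
    ((Polynomial.X : Polynomial ℂ) • (G a).map Polynomial.C
      + (1 : Matrix m m ℂ).map Polynomial.C).det
  have heval : ∀ a z, (Q a).eval z = (1 + z • G a).det := fun a z => by
    rw [← Polynomial.coe_evalRingHom, RingHom.map_det]
    congr 1
    ext i j
    by_cases hij : i = j
    · subst hij
      simp [add_comm, mul_comm z]
    · simp [hij, mul_comm z]
  have hdense := dense_compl_setOf_exists_isRoot (Q := Q) (N := Fintype.card m)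
    (fun a => Polynomial.natDegree_det_X_add_C_le _ _)
    (contDiff_coeff_det fun i j k => by
      cases k with
      | zero => simpa using contDiff_const
      | succ k =>
        simp only [Matrix.add_apply, Matrix.smul_apply, Matrix.map_apply, smul_eq_mul,
          Polynomial.coeff_add, Polynomial.coeff_X_mul, Polynomial.coeff_C]
        refine ContDiff.add ?_ contDiff_const
        split_ifs
        exacts [hG i j, contDiff_const])
    -- At `z = 0` the determinant is `1`, so `Q a` is not the zero polynomial.
    (fun a h => by simpa [h] using heval a 0)
  convert hdense using 1
  ext z
  simp [Polynomial.IsRoot, heval]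

/-! ### Kernels of finite rank -/

theorem contDiff_one_intervalIntegral {E : Type*} [NormedAddCommGroup E] [NormedSpace ℝ E]
    [CompleteSpace E] {f : ℝ → E} (hf : Continuous f) (a : ℝ) :
    ContDiff ℝ 1 fun x => ∫ t in a..x, f t := by
  have hd : ∀ x, HasDerivAt (fun x => ∫ t in a..x, f t) (f x) x :=
    fun x => hf.integral_hasStrictDerivAt a x |>.hasDerivAt
  rw [contDiff_one_iff_deriv]
  refine ⟨fun x => (hd x).differentiableAt, ?_⟩
  rwa [show deriv _ = f from funext fun x => (hd x).deriv]

theorem IsAccelerant.congr_ae {r : ℕ} {h h' : ℝ → ComplexMatrix r} (hh : IsAccelerant h)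
    (e : h =ᵐ[lebesgueOn (-1) 1] h') : IsAccelerant h' := by
  refine ⟨hh.1.congr e, fun α hα f hf => hh.2 α hα f ?_⟩
  rw [Filter.EventuallyEq, ae_restrict_iff' measurableSet_Ioo] at e
  filter_upwards [hf, ae_restrict_mem measurableSet_Ioo] with x hx hx01
  rw [← hx]
  congr 1
  refine intervalIntegral.integral_congr_ae ?_
  filter_upwards [(Measure.measurePreserving_sub_left volume x).quasiMeasurePreserving.ae e,
    Measure.ae_ne volume (1 : ℝ)] with t ht ht1 htα
  rw [uIoc_of_le hα.1.le] at htα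
  have := lt_of_le_of_ne (htα.2.trans hα.2) ht1
  rw [ht ⟨by linarith [hx01.1], by linarith [htα.1, hx01.2]⟩]

theorem IntervalIntegrable.continuous_clm_apply {E F : Type*} [NormedAddCommGroup E]
    [NormedSpace ℂ E] [NormedAddCommGroup F] [NormedSpace ℂ F] {f : ℝ → E} {a b : ℝ}
    (hf : IntervalIntegrable f volume a b) {T : ℝ → E →L[ℂ] F} (hT : Continuous T) :
    IntervalIntegrable (fun t => T t (f t)) volume a b := by
  obtain ⟨C, hC⟩ := (isCompact_uIcc (a := a) (b := b)).exists_bound_of_continuousOn hT.continuousOn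
  have hmeas : AEStronglyMeasurable (fun t => T t (f t)) (volume.restrict (uIoc a b)) := by
    exact isBoundedBilinearMap_apply.continuous.comp_aestronglyMeasurable
      ((hT.aestronglyMeasurable (μ := volume.restrict (uIoc a b))).prodMk
        hf.def'.aestronglyMeasurable)
  refine IntervalIntegrable.mono_fun' (hf.norm.const_mul C) hmeas ?_
  filter_upwards [ae_restrict_mem measurableSet_uIoc] with t ht
  refine (ContinuousLinearMap.le_opNorm _ _).trans ?_
  gcongr
  exact hC t (uIoc_subset_uIcc ht)

/-- The matrix of the operator `f ↦ ∫₀^α ∑ᵢ xⁱ Bᵢ(t) f(t) dt` on polynomials with coefficients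
in `ℂ^r`. -/
noncomputable def momentMatrix {n r : ℕ} (B : Fin n → ℝ → ComplexMatrix r) (α : ℝ) :
    Matrix (Fin n × Fin r) (Fin n × Fin r) ℂ :=
  fun i j => ∫ t in (0 : ℝ)..α, (t : ℂ) ^ (j.1 : ℕ) * B i.1 t i.2 j.2

theorem contDiff_momentMatrix {n r : ℕ} {B : Fin n → ℝ → ComplexMatrix r}
    (hB : ∀ i, Continuous (B i)) (i j : Fin n × Fin r) :
    ContDiff ℝ 1 fun α => momentMatrix B α i j := by
  refine contDiff_one_intervalIntegral ?_ 0
  exact (Complex.continuous_ofReal.pow _).mul (((hB i.1).matrix_elem i.2 j.2))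

/-- The equation itself forces `f` to be a polynomial in `x` on all of `(0, 1)`, with coefficients
`w i` that are integrals of `f` over `[0, α]`. Substituting this polynomial into those integrals
gives `(1 + z • momentMatrix B α) w = 0`, hence `w = 0`. -/
theorem eq_zero_of_separable_kernel {n r : ℕ} {B : Fin n → ℝ → ComplexMatrix r}
    (hB : ∀ i, Continuous (B i)) {h : ℝ → ComplexMatrix r}
    (hsep : ∀ x t, h (x - t) = ∑ i : Fin n, (x : ℂ) ^ (i : ℕ) • B i t) {z : ℂ} {α : ℝ}
    (hα : α ∈ Ioc (0 : ℝ) 1) (hdet : (1 + z • momentMatrix B α).det ≠ 0)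
    (f : Lp (EuclideanSpace ℂ (Fin r)) 2 (lebesgueOn 0 1))
    (hf : ∀ᵐ x ∂(lebesgueOn 0 1),
      f x + ∫ t in (0 : ℝ)..α, Matrix.toEuclideanCLM (𝕜 := ℂ) (z • h (x - t)) (f t) = 0) :
    f = 0 := by
  have hcl : Continuous fun M : ComplexMatrix r => Matrix.toEuclideanCLM (𝕜 := ℂ) M :=
    (AddMonoidHomClass.isometry_of_norm _ fun M => Matrix.l2_opNorm_toEuclideanCLM M).continuous
  have hfint : IntervalIntegrable f volume 0 α := by
    rw [intervalIntegrable_iff_integrableOn_Ioo_of_le hα.1.le]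
    exact IntegrableOn.mono_set ((Lp.memLp f).integrable (by norm_num))
      (Ioo_subset_Ioo_right hα.2)
  have hBint : ∀ i, IntervalIntegrable
      (fun t => Matrix.toEuclideanCLM (𝕜 := ℂ) (B i t) (f t)) volume 0 α := fun i =>
    hfint.continuous_clm_apply (hcl.comp (hB i))
  let w : Fin n → EuclideanSpace ℂ (Fin r) := fun i =>
    -(z • ∫ t in (0 : ℝ)..α, Matrix.toEuclideanCLM (𝕜 := ℂ) (B i t) (f t))
  have hfw : ∀ᵐ x ∂(lebesgueOn 0 1), f x = ∑ i : Fin n, (x : ℂ) ^ (i : ℕ) • w i := by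
    filter_upwards [hf] with x hx
    rw [eq_neg_of_add_eq_zero_left hx]
    simp only [hsep, map_smul, map_sum, smul_apply,
      sum_apply]
    rw [intervalIntegral.integral_smul,
      intervalIntegral.integral_finsetSum fun i _ => by
        exact IntervalIntegrable.smul (hBint i) ((x : ℂ) ^ (i : ℕ))]
    simp only [intervalIntegral.integral_smul, w, smul_neg, Finset.sum_neg_distrib,
      Finset.smul_sum]
    simp only [smul_comm z]
  have hfw' : ∀ᵐ t, t ∈ uIoc 0 α → f t = ∑ i : Fin n, (t : ℂ) ^ (i : ℕ) • w i := by
    rw [ae_restrict_iff' measurableSet_Ioo] at hfw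
    filter_upwards [hfw, Measure.ae_ne volume (1 : ℝ)] with t ht ht1 htα
    rw [uIoc_of_le hα.1.le] at htα
    exact ht ⟨htα.1, lt_of_le_of_ne (htα.2.trans hα.2) ht1⟩
  have hw : ∀ i a, w i a = -(z * ∑ j : Fin n × Fin r, momentMatrix B α (i, a) j * w j.1 j.2) := by
    intro i a
    have e1 : ∫ t in (0 : ℝ)..α, Matrix.toEuclideanCLM (𝕜 := ℂ) (B i t) (f t)
        = ∫ t in (0 : ℝ)..α, Matrix.toEuclideanCLM (𝕜 := ℂ) (B i t)
          (∑ j : Fin n, (t : ℂ) ^ (j : ℕ) • w j) := by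
      refine intervalIntegral.integral_congr_ae ?_
      filter_upwards [hfw'] with t ht hmem
      rw [ht hmem]
    have hcont : Continuous fun t : ℝ => Matrix.toEuclideanCLM (𝕜 := ℂ) (B i t)
          (∑ j : Fin n, (t : ℂ) ^ (j : ℕ) • w j) :=
      (hcl.comp (hB i)).clm_apply (by fun_prop)
    have e2 := ContinuousLinearMap.intervalIntegral_comp_comm (𝕜 := ℂ)
      (EuclideanSpace.proj a : EuclideanSpace ℂ (Fin r) →L[ℂ] ℂ)
      (hcont.intervalIntegrable (μ := volume) 0 α)
    simp only [PiLp.proj_apply] at e2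
    simp only [w, PiLp.neg_apply, PiLp.smul_apply, smul_eq_mul]
    rw [e1, ← e2]
    congr 2
    have e3 : ∀ t : ℝ, (Matrix.toEuclideanCLM (𝕜 := ℂ) (B i t)
          (∑ j : Fin n, (t : ℂ) ^ (j : ℕ) • w j)) a
        = ∑ j : Fin n × Fin r, ((t : ℂ) ^ (j.1 : ℕ) * B i t a j.2) * w j.1 j.2 := fun t => by
      rw [Fintype.sum_prod_type, map_sum, WithLp.ofLp_sum, Finset.sum_apply]
      refine Finset.sum_congr rfl fun j _ => ?_
      simp only [map_smul, PiLp.smul_apply, Matrix.ofLp_toEuclideanCLM, Matrix.mulVec, dotProduct,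
        smul_eq_mul, Finset.mul_sum, mul_assoc]
    simp only [e3]
    rw [intervalIntegral.integral_finsetSum]
    · simp only [intervalIntegral.integral_mul_const, momentMatrix]
      rfl
    · intro j _
      refine Continuous.intervalIntegrable ?_ _ _
      exact ((Complex.continuous_ofReal.pow _).mul ((hB i).matrix_elem a j.2)).mul continuous_const
  have hmul : (1 + z • momentMatrix B α).mulVec (fun j => w j.1 j.2) = 0 := by
    ext ⟨i, a⟩
    rw [Matrix.add_mulVec, Matrix.one_mulVec, Matrix.smul_mulVec]
    simp only [Pi.add_apply, Pi.smul_apply, Matrix.mulVec, dotProduct, smul_eq_mul, Pi.zero_apply]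
    nth_rw 1 [hw i a]
    exact neg_add_cancel _
  have hw0 : (fun j : Fin n × Fin r => w j.1 j.2) = 0 :=
    Matrix.eq_zero_of_mulVec_eq_zero hdet hmul
  rw [Lp.eq_zero_iff_ae_eq_zero]
  filter_upwards [hfw] with x hx
  have : ∀ i, w i = 0 := fun i => by
    ext a
    exact congrFun hw0 (i, a)
  simp [hx, this]

/-- Almost all multiples of a kernel `h` such that `h (x - t)` is a polynomial in `x` are
accelerants. -/
theorem dense_setOf_isAccelerant_smul {n r : ℕ} {B : Fin n → ℝ → ComplexMatrix r}
    (hB : ∀ i, Continuous (B i)) {h : ℝ → ComplexMatrix r}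
    (hsep : ∀ x t, h (x - t) = ∑ i : Fin n, (x : ℂ) ^ (i : ℕ) • B i t)
    (hint : Integrable h (lebesgueOn (-1) 1)) :
    Dense {z : ℂ | IsAccelerant fun x => z • h x} := by
  refine (dense_setOf_forall_det_one_add_smul_ne_zero (contDiff_momentMatrix hB)).mono ?_
  exact fun z hz => ⟨hint.smul z, fun α hα f hf =>
    eq_zero_of_separable_kernel hB hsep hα (hz α) f hf⟩

/-! ### Polynomial approximation and density -/

/-- Weierstrass approximation on `[-1, 1]` for functions with values in a normed space. -/
theorem exists_sum_eval_smul_near {E : Type*} [NormedAddCommGroup E] [NormedSpace ℝ E]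
    {g : ℝ → E} (hg : Continuous g) {ε : ℝ} (hε : 0 < ε) :
    ∃ (n : ℕ) (P : Fin n → Polynomial ℝ) (A : Fin n → E),
      ∀ t ∈ Icc (-1 : ℝ) 1, ‖g t - ∑ k, (P k).eval t • A k‖ ≤ ε := by
  -- Bernstein approximation lives on `[0, 1]`; `x ↦ 2 * x - 1` carries it to `[-1, 1]`.
  let G : C(unitInterval, E) := ⟨fun x => g (2 * x - 1), by fun_prop⟩
  obtain ⟨n, hn⟩ := ((Metric.tendsto_nhds.1 (bernsteinApproximation_uniform G)) ε hε).exists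
  refine ⟨n + 1, fun k => (bernsteinPolynomial ℝ n k).comp
    (Polynomial.C (1 / 2) * (Polynomial.X + 1)), fun k => G (bernstein.z k), fun t ht => ?_⟩
  have h := ((ContinuousMap.dist_lt_iff hε).1 hn)
    ⟨(t + 1) / 2, by constructor <;> linarith [ht.1, ht.2]⟩
  rw [bernsteinApproximation.apply, dist_comm, dist_eq_norm] at h
  refine le_trans (le_of_eq ?_) h.le
  congr 2
  · exact congrArg g (by ring)
  · refine Finset.sum_congr rfl fun k _ => ?_
    congr 1
    rw [bernstein_apply]
    simp only [bernsteinPolynomial, Polynomial.eval_comp, Polynomial.eval_mul, Polynomial.eval_pow,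
      Polynomial.eval_sub, Polynomial.eval_add, Polynomial.eval_C, Polynomial.eval_X,
      Polynomial.eval_one, Polynomial.eval_natCast]
    ring

/-- This is the Taylor expansion of each `P k` at `-t`, whose coefficients, the Hasse derivatives at
`-t`, are continuous in `t`. -/
theorem exists_sum_eval_smul_sub_eq {E : Type*} [NormedAddCommGroup E] [NormedSpace ℝ E]
    {m : ℕ} (P : Fin m → Polynomial ℝ) (A : Fin m → E) :
    ∃ (n : ℕ) (B : Fin n → ℝ → E), (∀ i, Continuous (B i)) ∧
      ∀ x t, ∑ k, (P k).eval (x - t) • A k = ∑ i : Fin n, x ^ (i : ℕ) • B i t := by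
  refine ⟨(Finset.univ.sup fun k => (P k).natDegree) + 1,
    fun i t => ∑ k, (Polynomial.hasseDeriv i (P k)).eval (-t) • A k, fun i => ?_, fun x t => ?_⟩
  · exact continuous_finsetSum _ fun k _ =>
      ((Polynomial.continuous _).comp continuous_neg).smul continuous_const
  · simp only [Finset.smul_sum, smul_smul]
    rw [Finset.sum_comm]
    refine Finset.sum_congr rfl fun k _ => ?_
    rw [← Finset.sum_smul, sub_eq_add_neg, ← Polynomial.taylor_eval,
      Polynomial.eval_eq_sum_range' (n := (Finset.univ.sup fun k => (P k).natDegree) + 1)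
        (by
          rw [Polynomial.natDegree_taylor, Nat.lt_succ_iff]
          exact Finset.le_sup (f := fun k => (P k).natDegree) (Finset.mem_univ k)),
      Finset.sum_range]
    simp only [Polynomial.taylor_coeff, mul_comm]

/-- The value `z = 1` is a limit of good multipliers, and `z ↦ z • q` is continuous into `L_p`. -/
theorem toLp_mem_closure_accelerants {p : ℝ≥0∞} [Fact (1 ≤ p)] {r m : ℕ}
    (P : Fin m → Polynomial ℝ) (A : Fin m → ComplexMatrix r)
    (hq : MemLp (fun t => ∑ k, (P k).eval t • A k) p (lebesgueOn (-1) 1)) :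
    hq.toLp ∈ closure (accelerants p r) := by
  obtain ⟨n, B, hB, hsep⟩ := exists_sum_eval_smul_sub_eq P A
  have hdense := dense_setOf_isAccelerant_smul hB
    (h := fun t => ∑ k, (P k).eval t • A k)
    (fun x t => by
      rw [hsep]
      exact Finset.sum_congr rfl fun i _ => by rw [← Complex.ofReal_pow, Complex.coe_smul])
    (hq.integrable Fact.out)
  have hcont : Continuous fun z : ℂ => z • hq.toLp := continuous_id.smul continuous_const
  have h1 := map_mem_closure (t := accelerants p r) hcont (hdense 1) (fun z hz =>
      IsAccelerant.congr_ae hz (by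
        filter_upwards [Lp.coeFn_smul z hq.toLp, hq.coeFn_toLp] with x h1 h2
        rw [h1, Pi.smul_apply, h2]))
  simpa using h1

theorem proposition3p2 (p : ℝ≥0∞) [Fact (1 ≤ p)] (hp : p ≠ ∞) (r : ℕ) :
    Dense (accelerants p r) := by
  intro h
  -- Passing to the closure of the closure allows approximation by polynomials, which need not be
  -- accelerants themselves.
  rw [← isClosed_closure.closure_eq, EMetric.mem_closure_iff]
  intro ε hε
  -- One `δ` pays for the continuous approximant `g`. A uniform error `δ` on an interval of length
  -- `2` costs at most `2 ^ (1 / p) * δ ≤ 2 * δ` in `L_p`.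
  obtain ⟨δ, hδ, hδε⟩ : ∃ δ : ℝ, 0 < δ ∧ ENNReal.ofReal δ + 2 * ENNReal.ofReal δ < ε := by
    obtain ⟨δ, hδ, h⟩ := ENNReal.lt_iff_exists_nnreal_btwn.1
      (ENNReal.div_pos hε.ne' (by norm_num : (4 : ℝ≥0∞) ≠ ∞))
    have hδ0 : (0 : ℝ≥0∞) < δ := hδ
    refine ⟨δ, by exact_mod_cast hδ0, ?_⟩
    rw [ENNReal.ofReal_coe_nnreal]
    calc (δ : ℝ≥0∞) + 2 * δ ≤ δ * 4 := by
          rw [show (4 : ℝ≥0∞) = 1 + 2 + 1 by norm_num, mul_add, mul_add, mul_one, mul_comm 2]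
          exact le_self_add
      _ < ε := (ENNReal.lt_div_iff_mul_lt (by norm_num) (by norm_num)).1 h
  obtain ⟨g, -, hg, hgc, hgm⟩ := (Lp.memLp h).exists_hasCompactSupport_eLpNorm_sub_le hp
    (ENNReal.ofReal_pos.2 hδ).ne'
  obtain ⟨m, P, A, hPA⟩ := exists_sum_eval_smul_near hgc hδ
  have hbound : ∀ᵐ t ∂(lebesgueOn (-1) 1), ‖(g - fun t => ∑ k, (P k).eval t • A k) t‖ ≤ δ := by
    filter_upwards [ae_restrict_mem measurableSet_Ioo] with t ht
    exact hPA t ⟨ht.1.le, ht.2.le⟩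
  have hqc : Continuous fun t => ∑ k, (P k).eval t • A k :=
    continuous_finsetSum _ fun k _ => (Polynomial.continuous _).smul continuous_const
  have hsub : MemLp (g - fun t => ∑ k, (P k).eval t • A k) p (lebesgueOn (-1) 1) :=
    MemLp.of_bound (hgc.sub hqc).aestronglyMeasurable δ hbound
  have hq : MemLp (fun t => ∑ k, (P k).eval t • A k) p (lebesgueOn (-1) 1) := by
    simpa using hgm.sub hsub
  refine ⟨hq.toLp, toLp_mem_closure_accelerants P A hq, ?_⟩
  rw [← Lp.toLp_coeFn h (Lp.memLp h), Lp.edist_toLp_toLp]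
  refine lt_of_le_of_lt ?_ hδε
  rw [← sub_add_sub_cancel (h : ℝ → ComplexMatrix r) g]
  refine (eLpNorm_add_le ((Lp.memLp h).sub hgm).aestronglyMeasurable hsub.aestronglyMeasurable
    Fact.out).trans (add_le_add hg ((eLpNorm_le_of_ae_bound hbound).trans ?_))
  gcongr
  have hp1 : 1 ≤ p.toReal := by
    simpa using ENNReal.toReal_mono hp (Fact.out : 1 ≤ p)
  have hvol : lebesgueOn (-1) 1 univ = 2 := by
    rw [Measure.restrict_apply_univ, Real.volume_Ioo]
    norm_num
  rw [hvol]
  simpa using ENNReal.rpow_le_rpow_of_exponent_le (by norm_num : (1 : ℝ≥0∞) ≤ 2)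
    (inv_le_one_of_one_le₀ hp1)
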